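/- Let $A=(a_{ij})_{1\le i,j\le 4}$ be the Cartan matrix of Dynkin type $F_4$, $$A=\begin{pmatrix}2&-1&0&0\\-1&2&-2&0\\0&-1&2&-1\\0&0&-1&2\end{pmatrix},$$ and fix any orientation of the $F_4$ Dynkin diagram, i.e. for each pair of adjacent nodes $i\ne j$ ($a_{ij}\neq 0$) exactly one of $i\to j$, $j\to i$. A frieze of Dynkin type $F_4$ is a mesh frieze on the associated Auslander–Reiten (translation) quiver, that is, a family of positive integers $f(i,m)$, for $1\le i\le 4$ and $m\in\mathbb Z$, such that for all $i$ and $m$ $$f(i,m)\,f(i,m+1)=1+\prod_{j\to i} f(j,m+1)^{-a_{ji}}\;\prod_{i\to j} f(j,m)^{-a_{ji}}.$$ Then the number of friezes of Dynkin type $F_4$ is exactly $112$. -/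

import Mathlib

/-- `arrow` is an orientation of the Dynkin diagram of the Cartan matrix `A`: arrows only join
adjacent nodes, and two adjacent nodes `i`, `j` are joined by exactly one of `i ⟶ j`, `j ⟶ i`. -/
def IsDynkinOrientation {ι : Type*} (A : Matrix ι ι ℤ) (arrow : ι → ι → Prop) : Prop :=
  (∀ i j, arrow i j → i ≠ j ∧ A i j ≠ 0) ∧
    ∀ i j, i ≠ j → A i j ≠ 0 → Xor (arrow i j) (arrow j i)

/-- Friezes of Dynkin type `A`, as mesh friezes on the (valued) Auslander–Reiten translation quiver
`ℤΔ` of the oriented Dynkin diagram `Δ`.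

The vertices of `ℤΔ` are the pairs `(i, m)` with `i` a node and `m : ℤ`; every arrow `i ⟶ j` of `Δ`
gives arrows `(i, m) ⟶ (j, m)` and `(j, m) ⟶ (i, m + 1)`. The mesh going from `(i, m)` to
`(i, m + 1)` therefore has the middle terms `(j, m + 1)` for `j ⟶ i` and `(j, m)` for `i ⟶ j`,
the one at `j` occurring with multiplicity `-A j i`. A frieze assigns a positive integer to every
vertex so that for every mesh the product of the two end terms is one plus the product of the
middle terms. -/
def IsDynkinFrieze {ι : Type*} [Fintype ι] [DecidableEq ι] (A : Matrix ι ι ℤ)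
    (arrow : ι → ι → Prop) [DecidableRel arrow] (f : ι → ℤ → ℕ) : Prop :=
  (∀ i m, 0 < f i m) ∧
    ∀ i m, f i m * f i (m + 1) =
      1 + ∏ j ∈ Finset.univ.erase i,
        (if arrow j i then f j (m + 1) else f j m) ^ (-A j i).toNat

/-!
A frieze of type `F₄` is governed by its values on the bipartite slices of the translation quiver.
Up to reindexing the rows, which removes the choice of orientation, a frieze is a sequence (a belt)
of slices `(a, b, c, d)`, consecutive ones being related by mutation at the nodes `1`, `3` and then
at `0`, `2`. Every slice satisfies the divisibility conditions `a ∣ b + 1`, `b ∣ a * c + 1`,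
`c ∣ b ^ 2 * d + 1`, `d ∣ c + 1`. The set `seeds` consists of `112` solutions of these conditions
and is stable under the mutations, so that each of them generates a belt of positive integers. It
remains to see that every belt meets `seeds`: it then stays there, and is determined by its slice
at `0`.

For this, consider a slice of the belt at which the weight `a ^ 7 * b ^ 14 * c ^ 10 * d ^ 5` is
minimal. As no mutation decreases the weight, multiplying the exchange relations gives
`a ^ 14 * b ^ 28 * c ^ 20 * d ^ 10 ≤
  (b + 1) ^ 7 * (a * c + 1) ^ 14 * (b ^ 2 * d + 1) ^ 10 * (c + 1) ^ 5`.
Since the Cartan matrix maps the exponents `(7, 14, 10, 5)` to `(0, 1, 1, 0)`, this says that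
`b * c` is at most a product of powers of `1 + 1 / b`, `1 + 1 / (a * c)`, `1 + 1 / (b ^ 2 * d)` and
`1 + 1 / c` (`inner_mul_le`). If `a`, `d` and their mutations are all at least `2`, then `b` and `c`
are at least `3`, and only finitely many small slices are left. If one of these four numbers is `1`,
the divisibility conditions become those of a diagram with three nodes, whose solutions are bounded
by elementary arguments (`le_of_leaf_zero_eq_one`, `le_of_leaf_three_eq_one`). In each case the
remaining slices are enumerated (`mem_seeds_of_minimal`).
-/

open Finset

/-! ### Seeds and their mutations -/

/-- The exchange conditions at a bipartite slice of `ℤF₄`: `q = (a, b, c, d)` lists the values at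
the four nodes, and each of them divides one plus the product of the neighbouring values. -/
def IsSeed (q : ℕ × ℕ × ℕ × ℕ) : Prop :=
  (0 < q.1 ∧ 0 < q.2.1 ∧ 0 < q.2.2.1 ∧ 0 < q.2.2.2) ∧
    q.1 ∣ q.2.1 + 1 ∧ q.2.1 ∣ q.1 * q.2.2.1 + 1 ∧
      q.2.2.1 ∣ q.2.1 ^ 2 * q.2.2.2 + 1 ∧ q.2.2.2 ∣ q.2.2.1 + 1

instance : DecidablePred IsSeed := fun q => by unfold IsSeed; infer_instance

/-- Simultaneous mutation of a slice at the nodes `0` and `2`. -/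
def mutateEven (q : ℕ × ℕ × ℕ × ℕ) : ℕ × ℕ × ℕ × ℕ :=
  ((q.2.1 + 1) / q.1, q.2.1, (q.2.1 ^ 2 * q.2.2.2 + 1) / q.2.2.1, q.2.2.2)

/-- Simultaneous mutation of a slice at the nodes `1` and `3`. -/
def mutateOdd (q : ℕ × ℕ × ℕ × ℕ) : ℕ × ℕ × ℕ × ℕ :=
  (q.1, (q.1 * q.2.2.1 + 1) / q.2.1, q.2.2.1, (q.2.2.1 + 1) / q.2.2.2)

/-- One slice from each of the sixteen orbits of the translation `mutateEven ∘ mutateOdd`. -/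
def seedRepresentatives : List (ℕ × ℕ × ℕ × ℕ) :=
  [(1, 1, 1, 1), (1, 1, 1, 2), (1, 1, 2, 1), (1, 1, 2, 3), (1, 1, 3, 2), (2, 1, 1, 1),
    (2, 1, 1, 2), (1, 2, 1, 2), (1, 3, 2, 1), (1, 2, 1, 1), (1, 2, 3, 2), (3, 2, 1, 2),
    (4, 3, 2, 1), (3, 2, 1, 1), (1, 3, 5, 1), (5, 4, 3, 2)]

/-- The slices occurring in friezes of type `F₄`: the translation has order seven. -/
def seeds : Finset (ℕ × ℕ × ℕ × ℕ) :=
  (seedRepresentatives.flatMap fun q =>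
    (List.range 7).map fun k => (mutateEven ∘ mutateOdd)^[k] q).toFinset

theorem card_seeds : #seeds = 112 := by decide +kernel

theorem isSeed_of_mem_seeds : ∀ q ∈ seeds, IsSeed q := by decide +kernel

theorem mutateEven_mem_seeds : ∀ q ∈ seeds, mutateEven q ∈ seeds := by decide +kernel

theorem mutateOdd_mem_seeds : ∀ q ∈ seeds, mutateOdd q ∈ seeds := by decide +kernel

theorem mutateEven_mutateEven : ∀ q ∈ seeds, mutateEven (mutateEven q) = q := by decide +kernel

theorem mutateOdd_mutateOdd : ∀ q ∈ seeds, mutateOdd (mutateOdd q) = q := by decide +kernel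

/-- `mutateEven` as a permutation of the seeds. -/
def evenPerm : Equiv.Perm seeds :=
  Function.Involutive.toPerm (fun q => ⟨mutateEven q, mutateEven_mem_seeds q q.2⟩)
    fun q => Subtype.ext (mutateEven_mutateEven q q.2)

/-- `mutateOdd` as a permutation of the seeds. -/
def oddPerm : Equiv.Perm seeds :=
  Function.Involutive.toPerm (fun q => ⟨mutateOdd q, mutateOdd_mem_seeds q q.2⟩)
    fun q => Subtype.ext (mutateOdd_mutateOdd q q.2)

/-! ### Divisibility systems of lower rank -/

theorem le_of_dvd_succ_of_dvd_sq_add_one {b d : ℕ} (hb : 0 < b) (hd : 0 < d) (h₁ : b ∣ d + 1)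
    (h₂ : d ∣ b ^ 2 + 1) : b ≤ 3 ∧ d ≤ 5 := by
  obtain ⟨t, ht⟩ := h₁
  have h₃ : d ∣ b + t := by
    have h : d ∣ d * b + (b + t) := by
      have : d * b + (b + t) = t * (b ^ 2 + 1) := by linear_combination b * ht
      rw [this]; exact h₂.mul_left t
    exact (Nat.dvd_add_right (dvd_mul_right d b)).1 h
  have h₄ := Nat.le_of_dvd (by omega) h₃
  -- `d = b * t - 1 ≤ b + t` leaves `(b - 1) * (t - 1) ≤ 2`.
  obtain rfl | hb2 := Nat.eq_or_lt_of_le (Nat.succ_le_of_lt hb)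
  · have : d ∣ 2 := h₂
    have := Nat.le_of_dvd (by norm_num) this
    omega
  have ht0 : 0 < t := by
    rcases Nat.eq_zero_or_pos t with rfl | h
    · omega
    · exact h
  obtain rfl | ht2 := Nat.eq_or_lt_of_le (Nat.succ_le_of_lt ht0)
  · have : d ∣ d * (d + 2) + 2 := by
      have e : d * (d + 2) + 2 = b ^ 2 + 1 := by
        obtain rfl : b = d + 1 := by omega
        ring
      rw [e]; exact h₂
    have := Nat.le_of_dvd (by norm_num) ((Nat.dvd_add_right (dvd_mul_right d _)).1 this)
    omega
  have hb3 : b ≤ 3 := by nlinarith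
  have ht3 : t ≤ 3 := by nlinarith
  interval_cases b <;> interval_cases t <;> omega

/-- The half `b ^ 2 ≤ c + 1` of the system at a slice with entry `1` at node `0`. The quotient
`(b ^ 2 + d) / c` is at most `2`, and the quotient `1` leads to `d ∣ b ^ 2 + 1`, `b ∣ d + 1`. Here
`d` is the mutated entry at node `3`. -/
theorem le_of_sq_add_dvd {b c d : ℕ} (hb : 0 < b) (hd : 0 < d) (h₁ : b ∣ c + 1)
    (h₂ : d ∣ c + 1) (h₃ : c ∣ b ^ 2 + d) (h₄ : b ^ 2 ≤ c + 1) : c ≤ 14 := by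
  by_contra! hc
  obtain ⟨g, hg⟩ := h₃
  have hd' := Nat.le_of_dvd (by omega) h₂
  have hg2 : g ≤ 2 := by
    by_contra! h
    nlinarith
  interval_cases g
  · have := pow_pos hb 2; omega
  · obtain rfl : c = b ^ 2 + d := by omega
    have h₅ : d ∣ b ^ 2 + 1 := (Nat.dvd_add_right (dvd_refl d)).1 (by convert h₂ using 1; ring)
    have h₆ : b ∣ d + 1 :=
      (Nat.dvd_add_right (Dvd.intro b (by ring : b * b = b ^ 2))).1 (by rwa [add_assoc] at h₁)
    obtain ⟨h₇, h₈⟩ := le_of_dvd_succ_of_dvd_sq_add_one hb hd h₆ h₅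
    have : b ^ 2 ≤ 3 ^ 2 := Nat.pow_le_pow_left h₇ 2
    omega
  · obtain ⟨k, hk⟩ := h₂
    have hk2 : k = 1 := by
      rcases Nat.lt_or_ge k 2 with h | h
      · interval_cases k <;> omega
      · have : d * 2 ≤ d * k := Nat.mul_le_mul_left d h
        omega
    subst hk2
    have h₅ : b ∣ 2 := by
      have e : c + 1 = b * b + 2 := by nlinarith
      rw [e] at h₁
      exact (Nat.dvd_add_right (dvd_mul_right b b)).1 h₁
    have := Nat.le_of_dvd (by norm_num) h₅
    have : b ^ 2 ≤ 2 ^ 2 := Nat.pow_le_pow_left this 2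
    omega

/-- A slice whose entry at node `0` is `1` has bounded entries. The exchange `b ↔ (c + 1) / b`,
`d ↔ (c + 1) / d` is a symmetry, so that `b ^ 2 ≤ c + 1` may be assumed. -/
theorem le_of_leaf_zero_eq_one {b c d : ℕ} (hb : 0 < b) (hd : 0 < d) (h₁ : b ∣ c + 1)
    (h₂ : c ∣ b ^ 2 * d + 1) (h₃ : d ∣ c + 1) : c ≤ 14 := by
  obtain ⟨e, he⟩ := id h₁
  obtain ⟨d', hd'⟩ := id h₃
  have he0 : 0 < e := Nat.pos_of_ne_zero (by rintro rfl; omega)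
  have hd0 : 0 < d' := Nat.pos_of_ne_zero (by rintro rfl; omega)
  rcases le_total b e with hbe | heb
  · refine le_of_sq_add_dvd hb hd0 h₁ (Dvd.intro_left d hd'.symm) ?_ (by rw [he]; nlinarith)
    have h : c ∣ c * b ^ 2 + (b ^ 2 + d') := by
      have : c * b ^ 2 + (b ^ 2 + d') = d' * (b ^ 2 * d + 1) := by linear_combination b ^ 2 * hd'
      rw [this]; exact h₂.mul_left d'
    exact (Nat.dvd_add_right (dvd_mul_right c _)).1 h
  · refine le_of_sq_add_dvd he0 hd (Dvd.intro_left b he.symm) h₃ ?_ (by rw [he]; nlinarith)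
    have h : c ∣ c * ((c + 2) * d) + (e ^ 2 + d) := by
      have : c * ((c + 2) * d) + (e ^ 2 + d) = e ^ 2 * (b ^ 2 * d + 1) := by
        linear_combination d * (c + 1 + b * e) * he
      rw [this]; exact h₂.mul_left (e ^ 2)
    exact (Nat.dvd_add_right (dvd_mul_right c _)).1 h

/-- The half `c ≤ g` of the system at a slice with entry `1` at node `3`. Then `c ≤ b`, the quotient
`(c + a) / b` is at most `2`, and the quotient `1` leads to `c ∣ a ^ 2 + 1`, `a ∣ c + 1`. Here `a` is
the mutated entry at node `0`. -/
theorem le_of_dvd_add_of_mul_eq_sq_add_one {a b c g : ℕ} (ha : 0 < a) (hc : 0 < c)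
    (h₁ : a ∣ b + 1) (h₂ : c * g = b ^ 2 + 1) (h₃ : b ∣ c + a) (h₄ : c ≤ g) : b ≤ 8 := by
  by_contra! hb
  have hcb : c ≤ b := by
    by_contra! h
    nlinarith
  have hab := Nat.le_of_dvd (by omega) h₁
  obtain ⟨k, hk⟩ := h₃
  have hk2 : k ≤ 2 := by
    by_contra! h
    nlinarith
  interval_cases k
  · omega
  · obtain rfl : b = c + a := by omega
    have h₅ : a ∣ c + 1 := (Nat.dvd_add_right (dvd_refl a)).1 (by convert h₁ using 1; ring)
    have h₆ : c ∣ a ^ 2 + 1 := by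
      have h : c ∣ c * (c + 2 * a) + (a ^ 2 + 1) := ⟨g, by linear_combination -h₂⟩
      exact (Nat.dvd_add_right (dvd_mul_right c _)).1 h
    have := le_of_dvd_succ_of_dvd_sq_add_one ha hc h₅ h₆
    omega
  · obtain ⟨l, hl⟩ := h₁
    have hl1 : l = 1 := by
      rcases Nat.lt_or_ge l 2 with h | h
      · interval_cases l <;> omega
      · have : a * 2 ≤ a * l := Nat.mul_le_mul_left a h
        omega
    subst hl1
    have h₅ : c ∣ c * (c + 2) + 2 := by
      obtain rfl : b = c + 1 := by omega
      exact ⟨g, by linear_combination -h₂⟩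
    have := Nat.le_of_dvd (by norm_num) ((Nat.dvd_add_right (dvd_mul_right c _)).1 h₅)
    omega

/-- A slice whose entry at node `3` is `1` has bounded entries. The exchange `a ↔ (b + 1) / a`,
`c ↔ (b ^ 2 + 1) / c` is a symmetry, so that `c ^ 2 ≤ b ^ 2 + 1` may be assumed. -/
theorem le_of_leaf_three_eq_one {a b c : ℕ} (ha : 0 < a) (hc : 0 < c)
    (h₁ : a ∣ b + 1) (h₂ : b ∣ a * c + 1) (h₃ : c ∣ b ^ 2 + 1) : b ≤ 8 := by
  obtain ⟨a', ha'⟩ := id h₁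
  obtain ⟨g, hg⟩ := h₃
  have ha0 : 0 < a' := Nat.pos_of_ne_zero (by rintro rfl; omega)
  have hg0 : 0 < g := Nat.pos_of_ne_zero (by rintro rfl; omega)
  rcases le_total c g with hcg | hgc
  · refine le_of_dvd_add_of_mul_eq_sq_add_one ha0 hc (Dvd.intro_left a ha'.symm) hg.symm ?_ hcg
    have h : b ∣ b * c + (c + a') := by
      have : b * c + (c + a') = a' * (a * c + 1) := by linear_combination c * ha'
      rw [this]; exact h₂.mul_left a'
    exact (Nat.dvd_add_right (dvd_mul_right b _)).1 h
  · refine le_of_dvd_add_of_mul_eq_sq_add_one ha hg0 h₁ (by rw [hg, mul_comm]) ?_ hgc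
    have h : b ∣ b * (b * a) + (g + a) := by
      have : b * (b * a) + (g + a) = g * (a * c + 1) := by linear_combination a * hg
      rw [this]; exact h₂.mul_left g
    exact (Nat.dvd_add_right (dvd_mul_right b _)).1 h

/-! ### Slices of minimal weight -/

/-- The weight of a slice. The Cartan matrix maps the vector of exponents
`(7, 14, 10, 5)` to `(0, 1, 1, 0)`, which is why minimality of the weight bounds the product of the
two inner entries. -/
def sliceWeight (q : ℕ × ℕ × ℕ × ℕ) : ℕ := q.1 ^ 7 * q.2.1 ^ 14 * q.2.2.1 ^ 10 * q.2.2.2 ^ 5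

/-- If no mutation decreases the weight, the product `b * c` of the inner entries is bounded by a
constant that depends only on lower bounds `B` and `C` of these entries. -/
theorem inner_mul_le {a b c d B C : ℕ} (ha : 2 ≤ a) (hd : 2 ≤ d) (hB : 0 < B) (hC : 0 < C)
    (hb : B ≤ b) (hc : C ≤ c) :
    a ^ 14 * b ^ 28 * c ^ 20 * d ^ 10 ≤
      (b + 1) ^ 7 * (a * c + 1) ^ 14 * (b ^ 2 * d + 1) ^ 10 * (c + 1) ^ 5 →
    (b * c : ℚ) ≤ (1 + 1 / B) ^ 7 * (1 + 1 / (2 * C)) ^ 14 * (1 + 1 / (2 * B ^ 2)) ^ 10 *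
      (1 + 1 / C) ^ 5 := by
  have key : ∀ {N n : ℚ}, 0 < N → N ≤ n → n + 1 ≤ (1 + 1 / N) * n := by
    intro N n hN hn
    rw [add_mul, one_mul, one_div_mul_eq_div]
    gcongr
    rwa [le_div_iff₀ hN, one_mul]
  have ha' : (2 : ℚ) ≤ a := mod_cast ha
  have hd' : (2 : ℚ) ≤ d := mod_cast hd
  have hB' : (0 : ℚ) < B := mod_cast hB
  have hC' : (0 : ℚ) < C := mod_cast hC
  have hb' : (B : ℚ) ≤ b := mod_cast hb
  have hc' : (C : ℚ) ≤ c := mod_cast hc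
  have hb0 : (0 : ℚ) < b := hB'.trans_le hb'
  have hc0 : (0 : ℚ) < c := hC'.trans_le hc'
  have h₁ := key hB' hb'
  have h₂ : (a * c + 1 : ℚ) ≤ (1 + 1 / (2 * C)) * (a * c) := key (by positivity) (by gcongr)
  have h₃ : (b ^ 2 * d + 1 : ℚ) ≤ (1 + 1 / (2 * B ^ 2)) * (b ^ 2 * d) :=
    key (by positivity) <| (mul_comm _ _).trans_le <|
      mul_le_mul (pow_le_pow_left₀ hB'.le hb' 2) hd' zero_le_two (by positivity)
  have h₄ := key hC' hc'
  have hpos : (0 : ℚ) < a ^ 14 * b ^ 27 * c ^ 19 * d ^ 10 := by positivity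
  have hle : ((b + 1) ^ 7 * (a * c + 1) ^ 14 * (b ^ 2 * d + 1) ^ 10 * (c + 1) ^ 5 : ℚ) ≤
      ((1 + 1 / B) * b) ^ 7 * ((1 + 1 / (2 * C)) * (a * c)) ^ 14 *
        ((1 + 1 / (2 * B ^ 2)) * (b ^ 2 * d)) ^ 10 * ((1 + 1 / C) * c) ^ 5 := by gcongr
  intro h
  refine le_of_mul_le_mul_right ?_ hpos
  calc (b * c : ℚ) * (a ^ 14 * b ^ 27 * c ^ 19 * d ^ 10)
      = ((a ^ 14 * b ^ 28 * c ^ 20 * d ^ 10 : ℕ) : ℚ) := by push_cast; ring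
    _ ≤ ((b + 1) ^ 7 * (a * c + 1) ^ 14 * (b ^ 2 * d + 1) ^ 10 * (c + 1) ^ 5 : ℕ) :=
      Nat.cast_le.2 h
    _ = (b + 1) ^ 7 * (a * c + 1) ^ 14 * (b ^ 2 * d + 1) ^ 10 * (c + 1) ^ 5 := by push_cast; rfl
    _ ≤ _ := hle
    _ = _ := by
      generalize (1 + 1 / (B : ℚ)) = x
      generalize (1 + 1 / (2 * (C : ℚ))) = y
      generalize (1 + 1 / (2 * (B : ℚ) ^ 2)) = z
      generalize (1 + 1 / (C : ℚ)) = w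
      ring

/-- The entry `1` at node `0` occurs in the slice or, in the second part, in its mutation. -/
theorem mem_seeds_of_leaf_zero : ∀ b ∈ range 16, ∀ c ∈ range 15, ∀ d ∈ range 16,
    (IsSeed (1, b, c, d) → (1, b, c, d) ∈ seeds) ∧
      (IsSeed (b + 1, b, c, d) → (b + 1, b, c, d) ∈ seeds) := by decide +kernel

/-- The entry `1` at node `3` occurs in the slice or, in the second part, in its mutation. -/
theorem mem_seeds_of_leaf_three : ∀ b ∈ range 9, ∀ a ∈ range 10, ∀ c ∈ range 66,
    (IsSeed (a, b, c, 1) → (a, b, c, 1) ∈ seeds) ∧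
      (IsSeed (a, b, c, c + 1) → (a, b, c, c + 1) ∈ seeds) := by decide +kernel

theorem mem_seeds_of_inner_lt : ∀ b ∈ range 19, ∀ c ∈ range 12, ∀ a ∈ range 20, ∀ d ∈ range 13,
    IsSeed (a, b, c, d) → (a, b, c, d) ∈ seeds := by decide +kernel

/-- A seed whose weight does not decrease under the two bipartite mutations is one of the
`112` listed ones. If one of the entries at the leaves, before or after mutation, is `1`, the
system has lower rank; otherwise minimality bounds the inner entries. -/
theorem mem_seeds_of_minimal {a b c d a' b' c' d' : ℕ}
    (hpos : 0 < a ∧ 0 < b ∧ 0 < c ∧ 0 < d)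
    (ha : a * a' = b + 1) (hb : b * b' = a * c + 1) (hc : c * c' = b ^ 2 * d + 1)
    (hd : d * d' = c + 1) (hac : a ^ 7 * c ^ 10 ≤ a' ^ 7 * c' ^ 10)
    (hbd : b ^ 14 * d ^ 5 ≤ b' ^ 14 * d' ^ 5) : (a, b, c, d) ∈ seeds := by
  obtain ⟨ha0, hb0, hc0, hd0⟩ := hpos
  have ha1 : a ∣ b + 1 := Dvd.intro _ ha
  have hb1 : b ∣ a * c + 1 := Dvd.intro _ hb
  have hc1 : c ∣ b ^ 2 * d + 1 := Dvd.intro _ hc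
  have hd1 : d ∣ c + 1 := Dvd.intro _ hd
  have hs : IsSeed (a, b, c, d) := ⟨⟨ha0, hb0, hc0, hd0⟩, ha1, hb1, hc1, hd1⟩
  have hle_a := Nat.le_of_dvd (by omega) ha1
  have hle_d := Nat.le_of_dvd (by omega) hd1
  have leaf_zero : b ∣ c + 1 → c < 15 ∧ b < 16 ∧ d < 16 := by
    intro h
    have := le_of_leaf_zero_eq_one hb0 hd0 h hc1 hd1
    have := Nat.le_of_dvd (by omega) h
    omega
  have leaf_three : c ∣ b ^ 2 + 1 → b < 9 ∧ a < 10 ∧ c < 66 := by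
    intro h
    have h₁ := le_of_leaf_three_eq_one ha0 hc0 ha1 hb1 h
    have h₂ := Nat.le_of_dvd (by omega) h
    have h₃ : b ^ 2 ≤ 8 ^ 2 := Nat.pow_le_pow_left h₁ 2
    omega
  have ha'0 : 0 < a' := Nat.pos_of_ne_zero (by rintro rfl; omega)
  have hd'0 : 0 < d' := Nat.pos_of_ne_zero (by rintro rfl; omega)
  obtain rfl | ha2 := Nat.eq_or_lt_of_le (Nat.succ_le_of_lt ha0)
  · obtain ⟨h₁, h₂, h₃⟩ := leaf_zero (by simpa using hb1)
    exact (mem_seeds_of_leaf_zero b (mem_range.2 h₂) c (mem_range.2 h₁) d (mem_range.2 h₃)).1 hs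
  obtain rfl | hd2 := Nat.eq_or_lt_of_le (Nat.succ_le_of_lt hd0)
  · obtain ⟨h₁, h₂, h₃⟩ := leaf_three (by simpa using hc1)
    exact (mem_seeds_of_leaf_three b (mem_range.2 h₁) a (mem_range.2 h₂) c (mem_range.2 h₃)).1 hs
  obtain rfl | ha'2 := Nat.eq_or_lt_of_le (Nat.succ_le_of_lt ha'0)
  · obtain rfl : a = b + 1 := by omega
    have h : b ∣ b * c + (c + 1) := by convert hb1 using 1; ring
    obtain ⟨h₁, h₂, h₃⟩ := leaf_zero ((Nat.dvd_add_right (dvd_mul_right b c)).1 h)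
    exact (mem_seeds_of_leaf_zero b (mem_range.2 h₂) c (mem_range.2 h₁) d (mem_range.2 h₃)).2 hs
  obtain rfl | hd'2 := Nat.eq_or_lt_of_le (Nat.succ_le_of_lt hd'0)
  · obtain rfl : d = c + 1 := by omega
    have h : c ∣ c * b ^ 2 + (b ^ 2 + 1) := by convert hc1 using 1; ring
    obtain ⟨h₁, h₂, h₃⟩ := leaf_three ((Nat.dvd_add_right (dvd_mul_right c _)).1 h)
    exact (mem_seeds_of_leaf_three b (mem_range.2 h₁) a (mem_range.2 h₂) c (mem_range.2 h₃)).2 hs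
  have hb3 : 3 ≤ b := by nlinarith
  have hc3 : 3 ≤ c := by nlinarith
  have hmin : a ^ 14 * b ^ 28 * c ^ 20 * d ^ 10 ≤
      (b + 1) ^ 7 * (a * c + 1) ^ 14 * (b ^ 2 * d + 1) ^ 10 * (c + 1) ^ 5 := by
    calc a ^ 14 * b ^ 28 * c ^ 20 * d ^ 10
        = (a ^ 7 * c ^ 10) * (a ^ 7 * c ^ 10) * ((b ^ 14 * d ^ 5) * (b ^ 14 * d ^ 5)) := by ring
      _ ≤ (a ^ 7 * c ^ 10) * (a' ^ 7 * c' ^ 10) * ((b ^ 14 * d ^ 5) * (b' ^ 14 * d' ^ 5)) := by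
        gcongr
      _ = (a * a') ^ 7 * (b * b') ^ 14 * (c * c') ^ 10 * (d * d') ^ 5 := by ring
      _ = _ := by rw [ha, hb, hc, hd]
  -- For `19 ≤ b`, `3 ≤ c` the bound on `b * c` is below `53 < 19 * 3`; for `3 ≤ b`, `12 ≤ c` it is
  -- below `34 < 3 * 12`.
  have hb19 : b < 19 := by
    by_contra! h
    have h₁ := inner_mul_le ha2 hd2 (by norm_num) (by norm_num) h hc3 hmin
    have h₂ : ((19 * 3 : ℕ) : ℚ) ≤ b * c := mod_cast Nat.mul_le_mul h hc3
    norm_num at h₁ h₂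
    linarith
  have hc12 : c < 12 := by
    by_contra! h
    have h₁ := inner_mul_le ha2 hd2 (by norm_num) (by norm_num) hb3 h hmin
    have h₂ : ((3 * 12 : ℕ) : ℚ) ≤ b * c := mod_cast Nat.mul_le_mul hb3 h
    norm_num at h₁ h₂
    linarith
  exact mem_seeds_of_inner_lt b (mem_range.2 hb19) c (mem_range.2 hc12) a
    (mem_range.2 (by omega)) d (mem_range.2 (by omega)) hs

/-! ### Belts of slices -/

/-- A sequence of positive bipartite slices in which each slice arises from the preceding one by
mutation at the nodes `1` and `3`, followed by mutation at the nodes `0` and `2`. -/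
def IsBelt (p : ℤ → ℕ × ℕ × ℕ × ℕ) : Prop :=
  ∀ m, (0 < (p m).1 ∧ 0 < (p m).2.1 ∧ 0 < (p m).2.2.1 ∧ 0 < (p m).2.2.2) ∧
    (p m).1 * (p (m + 1)).1 = 1 + (p (m + 1)).2.1 ∧
    (p m).2.1 * (p (m + 1)).2.1 = 1 + (p m).1 * (p m).2.2.1 ∧
    (p m).2.2.1 * (p (m + 1)).2.2.1 = 1 + (p (m + 1)).2.1 ^ 2 * (p (m + 1)).2.2.2 ∧
    (p m).2.2.2 * (p (m + 1)).2.2.2 = 1 + (p m).2.2.1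

/-- The slice between `p m` and `p (m + 1)`. -/
def midSlice (p : ℤ → ℕ × ℕ × ℕ × ℕ) (m : ℤ) : ℕ × ℕ × ℕ × ℕ :=
  ((p m).1, (p (m + 1)).2.1, (p m).2.2.1, (p (m + 1)).2.2.2)

theorem Nat.eq_div_of_mul_eq_one_add {x y z : ℕ} (hx : 0 < x) (h : x * y = 1 + z) :
    y = (z + 1) / x := by
  rw [add_comm z, ← h, Nat.mul_div_cancel_left y hx]

theorem IsBelt.midSlice_eq {p : ℤ → ℕ × ℕ × ℕ × ℕ} (hp : IsBelt p) (m : ℤ) :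
    midSlice p m = mutateOdd (p m) := by
  obtain ⟨⟨-, hb, -, hd⟩, -, h₁, -, h₃⟩ := hp m
  simp only [midSlice, mutateOdd, ← Nat.eq_div_of_mul_eq_one_add hb h₁,
    ← Nat.eq_div_of_mul_eq_one_add hd h₃]

theorem IsBelt.succ_eq {p : ℤ → ℕ × ℕ × ℕ × ℕ} (hp : IsBelt p) (m : ℤ) :
    p (m + 1) = mutateEven (midSlice p m) := by
  obtain ⟨⟨ha, -, hc, -⟩, h₀, -, h₂, -⟩ := hp m
  simp only [midSlice, mutateEven, ← Nat.eq_div_of_mul_eq_one_add ha h₀,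
    ← Nat.eq_div_of_mul_eq_one_add hc h₂]

theorem IsBelt.midSlice_eq_mutateEven {p : ℤ → ℕ × ℕ × ℕ × ℕ} (hp : IsBelt p) (m : ℤ) :
    midSlice p m = mutateEven (p (m + 1)) := by
  obtain ⟨-, h₀, -, h₂, -⟩ := hp m
  obtain ⟨⟨ha, -, hc, -⟩, -⟩ := hp (m + 1)
  simp only [midSlice, mutateEven, ← Nat.eq_div_of_mul_eq_one_add ha ((mul_comm _ _).trans h₀),
    ← Nat.eq_div_of_mul_eq_one_add hc ((mul_comm _ _).trans h₂)]

theorem IsBelt.eq_mutateOdd_midSlice {p : ℤ → ℕ × ℕ × ℕ × ℕ} (hp : IsBelt p) (m : ℤ) :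
    p m = mutateOdd (midSlice p m) := by
  obtain ⟨-, -, h₁, -, h₃⟩ := hp m
  obtain ⟨⟨-, hb, -, hd⟩, -⟩ := hp (m + 1)
  simp only [midSlice, mutateOdd, ← Nat.eq_div_of_mul_eq_one_add hb ((mul_comm _ _).trans h₁),
    ← Nat.eq_div_of_mul_eq_one_add hd ((mul_comm _ _).trans h₃)]

/-- A slice of least weight in the belt is a seed; mutations carry this to all other slices. -/
theorem IsBelt.mem_seeds {p : ℤ → ℕ × ℕ × ℕ × ℕ} (hp : IsBelt p) (m : ℤ) : p m ∈ seeds := by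
  let w : ℤ ⊕ ℤ → ℕ := Sum.elim (fun n => sliceWeight (p n)) (fun n => sliceWeight (midSlice p n))
  have hmin : ∀ j, w (Function.argmin w) ≤ w j := fun j => Function.argmin_le w j
  have hex : ∃ n, p n ∈ seeds := by
    rcases hi : Function.argmin w with n | n <;> rw [hi] at hmin
    · refine ⟨n, ?_⟩
      obtain ⟨h, -, h₁, -, h₃⟩ := hp n
      obtain ⟨⟨ka, -, kc, -⟩, k₀, -, k₂, -⟩ := hp (n - 1)
      have hl := hmin (Sum.inr (n - 1))
      have hr := hmin (Sum.inr n)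
      simp only [w, Sum.elim_inl, Sum.elim_inr, sliceWeight, midSlice, sub_add_cancel] at *
      obtain ⟨ha, hb, hc, hd⟩ := h
      refine mem_seeds_of_minimal ⟨ha, hb, hc, hd⟩ (by rw [mul_comm, k₀, add_comm])
        (by rw [h₁, add_comm]) (by rw [mul_comm, k₂, add_comm]) (by rw [h₃, add_comm]) ?_ ?_
      · refine Nat.le_of_mul_le_mul_right
          (c := (p n).2.1 ^ 14 * (p n).2.2.2 ^ 5) ?_ (by positivity)
        linarith
      · refine Nat.le_of_mul_le_mul_right
          (c := (p n).1 ^ 7 * (p n).2.2.1 ^ 10) ?_ (by positivity)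
        linarith
    · refine ⟨n, ?_⟩
      rw [hp.eq_mutateOdd_midSlice]
      apply mutateOdd_mem_seeds
      obtain ⟨⟨ha, -, hc, -⟩, h₀, h₁, h₂, h₃⟩ := hp n
      obtain ⟨⟨-, hb, -, hd⟩, -⟩ := hp (n + 1)
      have hl := hmin (Sum.inl n)
      have hr := hmin (Sum.inl (n + 1))
      simp only [w, Sum.elim_inl, Sum.elim_inr, sliceWeight, midSlice] at *
      refine mem_seeds_of_minimal ⟨ha, hb, hc, hd⟩ (by rw [h₀, add_comm])
        (by rw [mul_comm, h₁, add_comm]) (by rw [h₂, add_comm]) (by rw [mul_comm, h₃, add_comm])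
        ?_ ?_
      · refine Nat.le_of_mul_le_mul_right
          (c := (p (n + 1)).2.1 ^ 14 * (p (n + 1)).2.2.2 ^ 5) ?_ (by positivity)
        linarith
      · refine Nat.le_of_mul_le_mul_right
          (c := (p n).1 ^ 7 * (p n).2.2.1 ^ 10) ?_ (by positivity)
        linarith
  obtain ⟨n, hn⟩ := hex
  induction m using Int.inductionOn' (b := n) with
  | zero => exact hn
  | succ k _ hk =>
    rw [hp.succ_eq, hp.midSlice_eq]
    exact mutateEven_mem_seeds _ (mutateOdd_mem_seeds _ hk)
  | pred k _ hk =>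
    rw [hp.eq_mutateOdd_midSlice, hp.midSlice_eq_mutateEven, sub_add_cancel]
    exact mutateOdd_mem_seeds _ (mutateEven_mem_seeds _ hk)

/-- The belt through a given seed. -/
def beltOf (q : seeds) (m : ℤ) : ℕ × ℕ × ℕ × ℕ := ((evenPerm * oddPerm) ^ m) q

theorem beltOf_zero (q : seeds) : beltOf q 0 = q := by simp [beltOf]

theorem beltOf_succ (q : seeds) (m : ℤ) :
    beltOf q (m + 1) = mutateEven (mutateOdd (beltOf q m)) := by
  simp only [beltOf, add_comm m 1, zpow_one_add]
  rfl

theorem isBelt_beltOf (q : seeds) : IsBelt (beltOf q) := by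
  intro m
  have hq : beltOf q m ∈ seeds := Subtype.prop _
  rw [beltOf_succ]
  obtain ⟨h, -, h₁, -, h₃⟩ := isSeed_of_mem_seeds _ hq
  obtain ⟨-, k₀, -, k₂, -⟩ := isSeed_of_mem_seeds _ (mutateOdd_mem_seeds _ hq)
  refine ⟨h, ?_, ?_, ?_, ?_⟩
  · exact (Nat.mul_div_cancel' k₀).trans (add_comm _ _)
  · exact (Nat.mul_div_cancel' h₁).trans (add_comm _ _)
  · exact (Nat.mul_div_cancel' k₂).trans (add_comm _ _)
  · exact (Nat.mul_div_cancel' h₃).trans (add_comm _ _)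

theorem IsBelt.eq_beltOf {p : ℤ → ℕ × ℕ × ℕ × ℕ} (hp : IsBelt p) :
    p = beltOf ⟨p 0, hp.mem_seeds 0⟩ := by
  funext m
  induction m using Int.inductionOn' (b := 0) with
  | zero => rw [beltOf_zero]
  | succ k _ hk => rw [hp.succ_eq, hp.midSlice_eq, beltOf_succ, hk]
  | pred k _ hk =>
    have hq := isBelt_beltOf ⟨p 0, hp.mem_seeds 0⟩
    rw [hp.eq_mutateOdd_midSlice, hp.midSlice_eq_mutateEven, hq.eq_mutateOdd_midSlice,
      hq.midSlice_eq_mutateEven, sub_add_cancel, hk]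

/-- A belt is determined by its slice at `0`, and exactly the seeds occur there. -/
theorem ncard_isBelt : Set.ncard {p | IsBelt p} = 112 := by
  have h : {p | IsBelt p} = Set.range beltOf :=
    Set.ext fun p => ⟨fun hp => ⟨_, (IsBelt.eq_beltOf hp).symm⟩, by
      rintro ⟨q, rfl⟩; exact isBelt_beltOf q⟩
  have hinj : Function.Injective beltOf := fun q r hqr => Subtype.ext <| by
    rw [← beltOf_zero q, hqr, beltOf_zero]
  rw [h, ← Set.image_univ, Set.ncard_image_of_injective _ hinj, Set.ncard_univ,
    Nat.card_eq_fintype_card, Fintype.card_coe, card_seeds]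

/-! ### Orientations -/

/-- The families `f` of values on `ℤF₄` and the sequences of slices, where the
`m`-th slice takes the value of `f` at `(i, m + s i)` for each node `i`. -/
def sliceEquiv (s : Fin 4 → ℤ) : (Fin 4 → ℤ → ℕ) ≃ (ℤ → ℕ × ℕ × ℕ × ℕ) where
  toFun f m := (f 0 (m + s 0), f 1 (m + s 1), f 2 (m + s 2), f 3 (m + s 3))
  invFun p := ![fun m => (p (m - s 0)).1, fun m => (p (m - s 1)).2.1,
    fun m => (p (m - s 2)).2.2.1, fun m => (p (m - s 3)).2.2.2]
  left_inv f := by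
    funext i m
    fin_cases i <;> simp
  right_inv p := by
    funext m
    simp

/-- The mesh relations written out, with the choice of middle terms expressed by shifts. -/
theorem isDynkinFrieze_F₄_iff (arrow : Fin 4 → Fin 4 → Prop) [DecidableRel arrow]
    (f : Fin 4 → ℤ → ℕ) : IsDynkinFrieze CartanMatrix.F₄ arrow f ↔ (∀ i m, 0 < f i m) ∧
      ∀ m, f 0 m * f 0 (m + 1) = 1 + f 1 (m + if arrow 1 0 then 1 else 0) ∧
        f 1 m * f 1 (m + 1) = 1 + f 0 (m + if arrow 0 1 then 1 else 0) *
          f 2 (m + if arrow 2 1 then 1 else 0) ∧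
        f 2 m * f 2 (m + 1) = 1 + f 1 (m + if arrow 1 2 then 1 else 0) ^ 2 *
          f 3 (m + if arrow 3 2 then 1 else 0) ∧
        f 3 m * f 3 (m + 1) = 1 + f 2 (m + if arrow 2 3 then 1 else 0) := by
  have hshift : ∀ i j m, (if arrow j i then f j (m + 1) else f j m) =
      f j (m + if arrow j i then 1 else 0) := by
    intro i j m
    split_ifs <;> simp
  have e0 : univ.erase (0 : Fin 4) = {1, 2, 3} := by decide
  have e1 : univ.erase (1 : Fin 4) = {0, 2, 3} := by decide
  have e2 : univ.erase (2 : Fin 4) = {0, 1, 3} := by decide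
  have e3 : univ.erase (3 : Fin 4) = {0, 1, 2} := by decide
  unfold IsDynkinFrieze
  simp only [hshift]
  refine and_congr_right fun _ => ?_
  rw [forall_comm]
  refine forall_congr' fun m => ?_
  simp [Fin.forall_fin_succ, e0, e1, e2, e3, CartanMatrix.F₄]

/-- Reindexing each row of the translation quiver turns any orientation of the diagram into the
bipartite one, in which `1` and `3` are sources. -/
theorem isDynkinFrieze_iff_isBelt (arrow : Fin 4 → Fin 4 → Prop) [DecidableRel arrow]
    (h_arrow : IsDynkinOrientation CartanMatrix.F₄ arrow) :
    ∃ s : Fin 4 → ℤ, ∀ f,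
      IsDynkinFrieze CartanMatrix.F₄ arrow f ↔ IsBelt (sliceEquiv s f) := by
  have hone : ∀ i j, i ≠ j → CartanMatrix.F₄ i j ≠ 0 →
      (if arrow i j then (1 : ℤ) else 0) + (if arrow j i then 1 else 0) = 1 := by
    intro i j hij hA
    rcases h_arrow.2 i j hij hA with h | h <;> simp [h.1, h.2]
  have h01 := hone 0 1 (by decide) (by decide)
  have h12 := hone 1 2 (by decide) (by decide)
  have h23 := hone 2 3 (by decide) (by decide)
  simp only [isDynkinFrieze_F₄_iff]
  generalize (if arrow 0 1 then (1 : ℤ) else 0) = x at *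
  generalize (if arrow 1 0 then (1 : ℤ) else 0) = x' at *
  generalize (if arrow 1 2 then (1 : ℤ) else 0) = y' at *
  generalize (if arrow 2 1 then (1 : ℤ) else 0) = y at *
  generalize (if arrow 2 3 then (1 : ℤ) else 0) = z at *
  generalize (if arrow 3 2 then (1 : ℤ) else 0) = z' at *
  obtain rfl : x' = 1 - x := by omega
  obtain rfl : y' = 1 - y := by omega
  obtain rfl : z' = 1 - z := by omega
  refine ⟨![x, 0, y, y - z], fun f => ⟨fun ⟨hpos, h⟩ m => ?_, fun h => ⟨fun i m => ?_, fun m => ?_⟩⟩⟩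
  · obtain ⟨h₀, -⟩ := h (m + x)
    obtain ⟨-, h₁, -⟩ := h m
    obtain ⟨-, -, h₂, -⟩ := h (m + y)
    obtain ⟨-, -, -, h₃⟩ := h (m + (y - z))
    refine ⟨⟨hpos _ _, hpos _ _, hpos _ _, hpos _ _⟩, ?_, ?_, ?_, ?_⟩
    · convert h₀ using 3 <;> simp [sliceEquiv]
      ring_nf
    · convert h₁ using 3 <;> simp [sliceEquiv]
    · convert h₂ using 3 <;> simp [sliceEquiv] <;> ring_nf
    · convert h₃ using 3 <;> simp [sliceEquiv] <;> ring_nf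
  · have h' := (h (m - (![x, 0, y, y - z] : Fin 4 → ℤ) i)).1
    fin_cases i
    · simpa [sliceEquiv] using h'.1
    · simpa [sliceEquiv] using h'.2.1
    · simpa [sliceEquiv] using h'.2.2.1
    · simpa [sliceEquiv] using h'.2.2.2
  · obtain ⟨-, h₀, -⟩ := h (m - x)
    obtain ⟨-, -, h₁, -⟩ := h m
    obtain ⟨-, -, -, h₂, -⟩ := h (m - y)
    obtain ⟨-, -, -, -, h₃⟩ := h (m - (y - z))
    refine ⟨?_, ?_, ?_, ?_⟩
    · convert h₀ using 3 <;> simp [sliceEquiv] <;> ring_nf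
    · convert h₁ using 3 <;> simp [sliceEquiv]
    · convert h₂ using 3 <;> simp [sliceEquiv] <;> ring_nf
    · convert h₃ using 3 <;> simp [sliceEquiv] <;> ring_nf

theorem corollaryB2 (arrow : Fin 4 → Fin 4 → Prop) [DecidableRel arrow]
    (h_arrow : IsDynkinOrientation CartanMatrix.F₄ arrow) :
    Set.ncard {f : Fin 4 → ℤ → ℕ | IsDynkinFrieze CartanMatrix.F₄ arrow f} = 112 := by
  obtain ⟨s, hs⟩ := isDynkinFrieze_iff_isBelt arrow h_arrow
  have h : {f | IsDynkinFrieze CartanMatrix.F₄ arrow f} =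
      sliceEquiv s ⁻¹' {p | IsBelt p} := Set.ext hs
  rw [h, ← (sliceEquiv s).image_symm_eq_preimage,
    Set.ncard_image_of_injective _ (sliceEquiv s).symm.injective, ncard_isBelt]
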